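/- Let $\Gamma$ be a countable discrete group with identity $e$, and let $\sigma : \Gamma\times\Gamma\to\mathbb{T}$ be a cocycle, i.e. $\sigma(x,yz)\sigma(y,z)=\sigma(xy,z)\sigma(x,y)$ and $\sigma(x,e)=\sigma(e,x)=1$ for all $x,y,z\in\Gamma$. Let $(\pi,\mathcal{H}_\pi)$ be a $\sigma$-representation of $\Gamma$ on a separable complex Hilbert space, i.e. a map $\pi$ from $\Gamma$ to the unitary operators on $\mathcal{H}_\pi$ with $\pi(e)=I$ and $\pi(x)\pi(y)=\sigma(x,y)\pi(xy)$ for all $x,y\in\Gamma$. Assume that $\pi$ is square-integrable: there is a norm dense subspace $\mathcal{D}\subseteq\mathcal{H}_\pi$ such that $(\langle f,\pi(\gamma)g\rangle)_{\gamma\in\Gamma}\in\ell^2(\Gamma)$ for all $f\in\mathcal{H}_\pi$ and $g\in\mathcal{D}$. For a set $M$ of bounded operators on $\mathcal{H}_\pi$, let $M'$ be its commutant and $M''=(M')'$. The von Neumann algebra $\pi(\Gamma)''$ is called a factor if its center is trivial, $\pi(\Gamma)''\cap\pi(\Gamma)'=\mathbb{C}I$. An element $\gamma_0\in\Gamma$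 is $\sigma$-regular if $\sigma(\gamma_0,\gamma)=\sigma(\gamma,\gamma_0)$ for all $\gamma\in\Gamma$ commuting with $\gamma_0$. The pair $(\Gamma,\sigma)$ satisfies Kleppner's condition if every $\sigma$-regular element $\gamma_0\neq e$ has an infinite conjugacy class $\{\gamma\gamma_0\gamma^{-1}:\gamma\in\Gamma\}$. If $(\Gamma,\sigma)$ satisfies Kleppner's condition, then every closed subspace $\mathcal{K}\subseteq\mathcal{H}_\pi$ that is invariant under $\pi(\Gamma)$ and under $\pi(\Gamma)'$ is $\{0\}$ or $\mathcal{H}_\pi$, and $\pi(\Gamma)''$ is a factor. Moreover, these two conclusions are equivalent to each other, whether or not Kleppner's condition holds: every closed subspace invariant under $\pi(\Gamma)$ and $\pi(\Gamma)'$ is $\{0\}$ or $\mathcal{H}_\pi$ if and only if $\pi(\Gamma)''$ is a factor. -/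

import Mathlib

/-- A (normalized) cocycle, or multiplier, on a discrete group: a map `σ : Γ × Γ → 𝕋` with
`σ(x, yz) σ(y, z) = σ(xy, z) σ(x, y)` and `σ(x, e) = σ(e, x) = 1`.
Every map on a discrete group is Borel, so there is no measurability condition. -/
structure GroupCocycle (Γ : Type*) [Group Γ] where
  toFun : Γ → Γ → Circle
  cocycle' : ∀ x y z : Γ, toFun x (y * z) * toFun y z = toFun (x * y) z * toFun x y
  map_one_right' : ∀ x : Γ, toFun x 1 = 1
  map_one_left' : ∀ x : Γ, toFun 1 x = 1

namespace GroupCocycle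

instance instCoeFun (Γ : Type*) [Group Γ] :
    CoeFun (GroupCocycle Γ) (fun _ => Γ → Γ → Circle) := ⟨GroupCocycle.toFun⟩

/-- `γ₀` is `σ`-regular if `σ(γ₀, γ) = σ(γ, γ₀)` for all `γ` commuting with `γ₀`. -/
def IsRegularElement {Γ : Type*} [Group Γ] (σ : GroupCocycle Γ) (γ₀ : Γ) : Prop :=
  ∀ γ : Γ, Commute γ γ₀ → σ γ₀ γ = σ γ γ₀

/-- Kleppner's condition: every `σ`-regular element other than the identity has an infinite
conjugacy class. -/
def Kleppner {Γ : Type*} [Group Γ] (σ : GroupCocycle Γ) : Prop :=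
  ∀ γ₀ : Γ, γ₀ ≠ 1 → σ.IsRegularElement γ₀ →
    (Set.range (fun γ : Γ => γ * γ₀ * γ⁻¹)).Infinite

end GroupCocycle

/-- A projective unitary representation of the discrete group `Γ` on the Hilbert space `H` with
cocycle `σ`, that is, a `σ`-representation. -/
structure ProjUnitaryRep {Γ : Type*} [Group Γ] (σ : GroupCocycle Γ)
    (H : Type*) [NormedAddCommGroup H] [InnerProductSpace ℂ H] [CompleteSpace H] where
  toFun : Γ → unitary (H →L[ℂ] H)
  map_mul' : ∀ x y : Γ, (toFun x : H →L[ℂ] H) * (toFun y : H →L[ℂ] H)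
    = (σ x y : ℂ) • (toFun (x * y) : H →L[ℂ] H)
  map_one' : toFun 1 = 1

namespace ProjUnitaryRep

/-- The operator `π(γ)`. -/
def op {Γ : Type*} [Group Γ] {σ : GroupCocycle Γ}
    {H : Type*} [NormedAddCommGroup H] [InnerProductSpace ℂ H] [CompleteSpace H]
    (π : ProjUnitaryRep σ H) (γ : Γ) : H →L[ℂ] H := (π.toFun γ : H →L[ℂ] H)

/-- `π` is square-integrable: there is a norm dense subspace `D` of `H` such that the matrix
coefficient `γ ↦ ⟨f, π(γ) g⟩` is in `ℓ²(Γ)` for all `f ∈ H` and `g ∈ D`.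
(Mathlib's inner product is linear in its second argument.) -/
def IsSquareIntegrable {Γ : Type*} [Group Γ] {σ : GroupCocycle Γ}
    {H : Type*} [NormedAddCommGroup H] [InnerProductSpace ℂ H] [CompleteSpace H]
    (π : ProjUnitaryRep σ H) : Prop :=
  ∃ D : Submodule ℂ H, Dense (D : Set H) ∧
    ∀ f : H, ∀ g ∈ D, Memℓp (fun γ : Γ => inner ℂ (π.op γ g) f) 2

/-- The commutant `π(Γ)'`. -/
def commutant {Γ : Type*} [Group Γ] {σ : GroupCocycle Γ}
    {H : Type*} [NormedAddCommGroup H] [InnerProductSpace ℂ H] [CompleteSpace H]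
    (π : ProjUnitaryRep σ H) : Set (H →L[ℂ] H) :=
  Set.centralizer (Set.range π.op)

theorem star_mem_commutant {Γ : Type*} [Group Γ] {σ : GroupCocycle Γ}
    {H : Type*} [NormedAddCommGroup H] [InnerProductSpace ℂ H] [CompleteSpace H]
    (π : ProjUnitaryRep σ H) {T : H →L[ℂ] H} (hT : T ∈ π.commutant) :
    star T ∈ π.commutant := by
  rintro _ ⟨γ, rfl⟩
  have h1 : π.op γ * T = T * π.op γ := hT _ ⟨γ, rfl⟩
  have h2 : star (π.op γ) * π.op γ = 1 := Unitary.coe_star_mul_self (π.toFun γ)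
  have h3 : π.op γ * star (π.op γ) = 1 := Unitary.coe_mul_star_self (π.toFun γ)
  have h4 : T * star (π.op γ) = star (π.op γ) * T := by
    calc T * star (π.op γ)
        = star (π.op γ) * (π.op γ * T) * star (π.op γ) := by
          rw [← mul_assoc, h2, one_mul]
      _ = star (π.op γ) * T * (π.op γ * star (π.op γ)) := by
          rw [h1]; simp only [mul_assoc]
      _ = star (π.op γ) * T := by rw [h3, mul_one]
  simpa using congrArg star h4

/-- The von Neumann algebra `π(Γ)''`, the double commutant of `π(Γ)`. -/
def vonNeumann {Γ : Type*} [Group Γ] {σ : GroupCocycle Γ}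
    {H : Type*} [NormedAddCommGroup H] [InnerProductSpace ℂ H] [CompleteSpace H]
    (π : ProjUnitaryRep σ H) : VonNeumannAlgebra H where
  toStarSubalgebra :=
    { Subalgebra.centralizer ℂ π.commutant with
      star_mem' := by
        intro T hT S hS
        have h : star S * T = T * star S := hT _ (π.star_mem_commutant hS)
        simpa using (congrArg star h).symm }
  centralizer_centralizer' := Set.centralizer_centralizer_centralizer π.commutant

theorem coe_vonNeumann {Γ : Type*} [Group Γ] {σ : GroupCocycle Γ}
    {H : Type*} [NormedAddCommGroup H] [InnerProductSpace ℂ H] [CompleteSpace H]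
    (π : ProjUnitaryRep σ H) :
    (π.vonNeumann : Set (H →L[ℂ] H)) = Set.centralizer (Set.centralizer (Set.range π.op)) :=
  rfl

/-- `K` is doubly invariant: invariant under `π(Γ)` and under `π(Γ)'`. -/
def IsDoublyInvariant {Γ : Type*} [Group Γ] {σ : GroupCocycle Γ}
    {H : Type*} [NormedAddCommGroup H] [InnerProductSpace ℂ H] [CompleteSpace H]
    (π : ProjUnitaryRep σ H) (K : Submodule ℂ H) : Prop :=
  (∀ γ : Γ, ∀ f ∈ K, π.op γ f ∈ K) ∧ (∀ T ∈ π.commutant, ∀ f ∈ K, T f ∈ K)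

end ProjUnitaryRep

/-- A von Neumann algebra `M` is a factor if its center `M ∩ M'` is `ℂ I`. -/
def VonNeumannAlgebra.IsFactor
    {H : Type*} [NormedAddCommGroup H] [InnerProductSpace ℂ H] [CompleteSpace H]
    (M : VonNeumannAlgebra H) : Prop :=
  (M : Set (H →L[ℂ] H)) ∩ (M.commutant : Set (H →L[ℂ] H))
    = Set.range (fun z : ℂ => z • (1 : H →L[ℂ] H))

/-! Let `K` be closed, doubly invariant and neither `⊥` nor `⊤`. Pick nonzero `f ∈ K` and `f' ∈ Kᗮ`,
and `g`, `g'` in the dense subspace `D` with `⟨g, f⟩ ≠ 0` and `⟨g', f'⟩ ≠ 0`. The coefficient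
operators `C_g`, `C_g'` intertwine `π` with twisted left translations on `ℓ²(Γ)`. Hence any `A`
commuting with these translations gives `C_g'* A C_g ∈ π(Γ)'`, which preserves `K`, so `A C_g K ⊥
C_g' f'`. Right translations commute with left ones, so the span `V` of all `A C_g K` is invariant
under both; `V` and `Vᗮ` are both nonzero. Kleppner's condition forbids this
(`GroupCocycle.Kleppner.eq_zero_or_eq_zero`): the projection of `δ_e` onto `Vᗮ` is a multiple of
`δ_e`, which is cyclic for left translations. The equivalence holds because projections onto closed
doubly invariant subspaces are central, while kernels of continuous functions of a central operator
are doubly invariant. -/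

/-! ### Twisted translations on `ℓ²(Γ)` -/

/-- Reindexing along a bijection followed by multiplication by a phase, as a unitary
operator on `ℓ²`. -/
noncomputable def weightedReindex {ι : Type*} (e : ι ≃ ι) (c : ι → Circle) :
    lp (fun _ : ι => ℂ) 2 ≃ₗᵢ[ℂ] lp (fun _ : ι => ℂ) 2 := by
  have mem : ∀ (e : ι ≃ ι) (c : ι → Circle) (f : lp (fun _ : ι => ℂ) 2),
      Memℓp (fun z => (c z : ℂ) * f (e z)) 2 := by
    intro e c f
    have hs := (lp.memℓp f).summable (by simp)
    refine memℓp_gen ?_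
    simpa [Function.comp_def, Circle.norm_coe] using e.summable_iff.mpr hs
  refine
    { toFun := fun f => ⟨fun z => (c z : ℂ) * f (e z), mem e c f⟩
      invFun := fun f => ⟨fun z => (((c (e.symm z))⁻¹ : Circle) : ℂ) * f (e.symm z),
        mem e.symm (fun z => (c (e.symm z))⁻¹) f⟩
      map_add' := fun f g => by ext z; exact mul_add _ _ _
      map_smul' := fun a f => by ext z; simp [mul_left_comm]
      left_inv := fun f => by ext z; simp
      right_inv := fun f => by ext z; simp
      norm_map' := fun f => ?_ }
  have h2 : 0 < (2 : ENNReal).toReal := by simp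
  rw [LinearEquiv.coe_mk, LinearMap.coe_mk, AddHom.coe_mk, lp.norm_eq_tsum_rpow h2,
    lp.norm_eq_tsum_rpow h2]
  congr 1
  rw [← e.tsum_eq (fun z => ‖f z‖ ^ (2 : ENNReal).toReal)]
  simp [Circle.norm_coe]

namespace GroupCocycle

/-- The adjoint of the twisted left translation by `x`. -/
noncomputable def leftTranslation {Γ : Type*} [Group Γ] (σ : GroupCocycle Γ) (x : Γ) :
    lp (fun _ : Γ => ℂ) 2 ≃ₗᵢ[ℂ] lp (fun _ : Γ => ℂ) 2 :=
  weightedReindex (Equiv.mulLeft x) (fun z => (σ x z)⁻¹)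

/-- The adjoint of the twisted right translation by `x`. -/
noncomputable def rightTranslation {Γ : Type*} [Group Γ] (σ : GroupCocycle Γ) (x : Γ) :
    lp (fun _ : Γ => ℂ) 2 ≃ₗᵢ[ℂ] lp (fun _ : Γ => ℂ) 2 :=
  weightedReindex (Equiv.mulRight x) (fun z => (σ z x)⁻¹)

theorem leftTranslation_apply {Γ : Type*} [Group Γ] (σ : GroupCocycle Γ) (x : Γ)
    (f : lp (fun _ : Γ => ℂ) 2) (z : Γ) :
    σ.leftTranslation x f z = (((σ x z)⁻¹ : Circle) : ℂ) * f (x * z) := rfl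

theorem rightTranslation_apply {Γ : Type*} [Group Γ] (σ : GroupCocycle Γ) (x : Γ)
    (f : lp (fun _ : Γ => ℂ) 2) (z : Γ) :
    σ.rightTranslation x f z = (((σ z x)⁻¹ : Circle) : ℂ) * f (z * x) := rfl

/-- This is the cocycle identity at `(x, z, y)`. -/
theorem leftTranslation_rightTranslation {Γ : Type*} [Group Γ] (σ : GroupCocycle Γ) (x y : Γ)
    (f : lp (fun _ : Γ => ℂ) 2) :
    σ.leftTranslation x (σ.rightTranslation y f)
      = σ.rightTranslation y (σ.leftTranslation x f) := by
  ext z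
  simp only [leftTranslation_apply, rightTranslation_apply, ← mul_assoc,
    ← Circle.coe_mul, ← mul_inv]
  rw [mul_comm (σ x z), mul_comm (σ z y), σ.cocycle' x z y]

theorem apply_inv_comm {Γ : Type*} [Group Γ] (σ : GroupCocycle Γ) (x : Γ) :
    σ x x⁻¹ = σ x⁻¹ x := by
  have h := σ.cocycle' x x⁻¹ x
  simpa [σ.map_one_left', σ.map_one_right'] using h.symm

theorem leftTranslation_single_one {Γ : Type*} [Group Γ] [DecidableEq Γ] (σ : GroupCocycle Γ)
    (x : Γ) (a : ℂ) :
    σ.leftTranslation x (lp.single 2 1 a)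
      = ((((σ x x⁻¹)⁻¹ : Circle) : ℂ) • lp.single 2 x⁻¹ a : lp (fun _ : Γ => ℂ) 2) := by
  ext z
  by_cases hz : z = x⁻¹
  · subst hz
    simp [leftTranslation_apply]
  · have hz' : x * z ≠ 1 := fun h => hz (eq_inv_of_mul_eq_one_right h)
    simp [leftTranslation_apply, hz, hz']

theorem rightTranslation_single_one {Γ : Type*} [Group Γ] [DecidableEq Γ] (σ : GroupCocycle Γ)
    (x : Γ) (a : ℂ) :
    σ.rightTranslation x (lp.single 2 1 a) = σ.leftTranslation x (lp.single 2 1 a) := by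
  rw [leftTranslation_single_one, apply_inv_comm]
  ext z
  by_cases hz : z = x⁻¹
  · subst hz
    simp [rightTranslation_apply]
  · have hz' : z * x ≠ 1 := fun h => hz (eq_inv_of_mul_eq_one_left h)
    simp [rightTranslation_apply, hz, hz']

end GroupCocycle

/-! ### Kleppner's condition and bi-invariant subspaces of `ℓ²(Γ)` -/

/-- An element of `ℓ²` whose modulus is constant on an infinite set vanishes there. -/
theorem lp.apply_eq_zero_of_infinite {ι : Type*} (a : lp (fun _ : ι => ℂ) 2) (w : ι) {S : Set ι}
    (hS : S.Infinite) (h : ∀ z ∈ S, ‖a z‖ = ‖a w‖) : a w = 0 := by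
  by_contra hw
  have hs := (lp.memℓp a).summable (by simp)
  have hpos : 0 < ‖a w‖ ^ (2 : ENNReal).toReal := by positivity
  have hev := hs.tendsto_cofinite_zero.eventually (gt_mem_nhds hpos)
  rw [Filter.eventually_cofinite] at hev
  refine hS (hev.subset fun z hz => ?_)
  simp [h z hz]

namespace GroupCocycle

/-- Under Kleppner's condition, the multiples of `δ_e` are the only vectors of `ℓ²(Γ)` on which
left and right twisted translations agree. -/
theorem Kleppner.apply_eq_zero {Γ : Type*} [Group Γ] {σ : GroupCocycle Γ} (hσ : σ.Kleppner)
    {a : lp (fun _ : Γ => ℂ) 2} (ha : ∀ x, σ.leftTranslation x a = σ.rightTranslation x a)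
    {w : Γ} (hw : w ≠ 1) : a w = 0 := by
  have key : ∀ x z, (((σ x z)⁻¹ : Circle) : ℂ) * a (x * z)
      = (((σ z x)⁻¹ : Circle) : ℂ) * a (z * x) := fun x z => by
    rw [← leftTranslation_apply, ← rightTranslation_apply, ha]
  by_cases hreg : σ.IsRegularElement w
  · refine lp.apply_eq_zero_of_infinite a w (hσ w hw hreg) ?_
    rintro _ ⟨x, rfl⟩
    -- The phases have modulus one, so `‖a‖` is constant on the conjugacy class of `w`.
    have := congrArg norm (key x (w * x⁻¹))
    simpa [mul_assoc, Circle.norm_coe] using this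
  · simp only [IsRegularElement, not_forall] at hreg
    obtain ⟨x, hx, hne⟩ := hreg
    by_contra haw
    have h1 : x * (x⁻¹ * w) = w := by group
    have h2 : x⁻¹ * w * x = w := by rw [mul_assoc, ← hx.eq]; group
    -- Since `x` commutes with `w`, both sides involve `a w`. If `a w ≠ 0` the phases agree, and the
    -- cocycle identity at `(x, x⁻¹ * w, x)` turns this into `σ x w = σ w x`.
    have h3 := key x (x⁻¹ * w)
    rw [h1, h2] at h3
    have h4 : σ x (x⁻¹ * w) = σ (x⁻¹ * w) x :=
      inv_injective (Circle.ext (mul_right_cancel₀ haw h3))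
    have h5 := σ.cocycle' x (x⁻¹ * w) x
    rw [h1, h2, h4] at h5
    exact hne (mul_right_cancel h5).symm

/-- A subspace containing `δ_e` and invariant under the twisted left translations is dense. -/
theorem eq_zero_of_mem_orthogonal {Γ : Type*} [Group Γ] [DecidableEq Γ] (σ : GroupCocycle Γ)
    {M : Submodule ℂ (lp (fun _ : Γ => ℂ) 2)}
    (hM : ∀ x, ∀ v ∈ M, σ.leftTranslation x v ∈ M) (h1 : lp.single 2 1 (1 : ℂ) ∈ M)
    {w : lp (fun _ : Γ => ℂ) 2} (hw : w ∈ Mᗮ) : w = 0 := by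
  ext z
  have h2 := hM z⁻¹ _ h1
  rw [leftTranslation_single_one, inv_inv] at h2
  have h3 := (Submodule.smul_mem_iff M (by simp)).1 h2
  have h4 := hw _ h3
  rw [lp.inner_single_left] at h4
  simpa using h4

end GroupCocycle

theorem LinearIsometryEquiv.map_mem_orthogonal {E : Type*} [NormedAddCommGroup E]
    [InnerProductSpace ℂ E] (U : E ≃ₗᵢ[ℂ] E) {V : Submodule ℂ E}
    (hV : ∀ v ∈ V, U.symm v ∈ V) {w : E} (hw : w ∈ Vᗮ) : U w ∈ Vᗮ := by
  intro v hv
  rw [← U.apply_symm_apply v, U.inner_map_map]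
  exact hw _ (hV v hv)

theorem LinearIsometryEquiv.map_starProjection_of_invariant {E : Type*} [NormedAddCommGroup E]
    [InnerProductSpace ℂ E] (U : E ≃ₗᵢ[ℂ] E) {V : Submodule ℂ E} [V.HasOrthogonalProjection]
    (hV : ∀ v ∈ V, U v ∈ V) (hV' : ∀ v ∈ V, U.symm v ∈ V) (w : E) :
    U (V.starProjection w) = V.starProjection (U w) := by
  refine (Submodule.eq_starProjection_of_mem_orthogonal (hV _ (by simp)) ?_).symm
  rw [← map_sub]
  exact U.map_mem_orthogonal hV' (V.sub_starProjection_mem_orthogonal w)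

/-- Under Kleppner's condition, a subspace of `ℓ²(Γ)` invariant under the twisted left and right
translations and their inverses is either zero or dense. -/
theorem GroupCocycle.Kleppner.eq_zero_or_eq_zero {Γ : Type*} [Group Γ] {σ : GroupCocycle Γ}
    (hσ : σ.Kleppner) {V : Submodule ℂ (lp (fun _ : Γ => ℂ) 2)}
    (hL : ∀ x, ∀ v ∈ V, σ.leftTranslation x v ∈ V)
    (hL' : ∀ x, ∀ v ∈ V, (σ.leftTranslation x).symm v ∈ V)
    (hR : ∀ x, ∀ v ∈ V, σ.rightTranslation x v ∈ V)
    (hR' : ∀ x, ∀ v ∈ V, (σ.rightTranslation x).symm v ∈ V)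
    {u u' : lp (fun _ : Γ => ℂ) 2} (hu : u ∈ V) (hu' : u' ∈ Vᗮ) : u = 0 ∨ u' = 0 := by
  classical
  have hL1 : ∀ x, ∀ v ∈ Vᗮ, σ.leftTranslation x v ∈ Vᗮ := fun x v hv =>
    (σ.leftTranslation x).map_mem_orthogonal (hL' x) hv
  have hL1' : ∀ x, ∀ v ∈ Vᗮ, (σ.leftTranslation x).symm v ∈ Vᗮ := fun x v hv =>
    (σ.leftTranslation x).symm.map_mem_orthogonal (by simpa using hL x) hv
  have hR1 : ∀ x, ∀ v ∈ Vᗮ, σ.rightTranslation x v ∈ Vᗮ := fun x v hv =>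
    (σ.rightTranslation x).map_mem_orthogonal (hR' x) hv
  have hR1' : ∀ x, ∀ v ∈ Vᗮ, (σ.rightTranslation x).symm v ∈ Vᗮ := fun x v hv =>
    (σ.rightTranslation x).symm.map_mem_orthogonal (by simpa using hR x) hv
  have hL2 : ∀ x, ∀ v ∈ Vᗮᗮ, σ.leftTranslation x v ∈ Vᗮᗮ := fun x v hv =>
    (σ.leftTranslation x).map_mem_orthogonal (hL1' x) hv
  set d : lp (fun _ : Γ => ℂ) 2 := lp.single 2 1 (1 : ℂ) with hd
  -- `V` need not be closed, so the projection is taken onto `Vᗮ`. It commutes with both families of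
  -- translations, which agree on `δ_e`.
  set a := Vᗮ.starProjection d with ha
  have hau : a = a 1 • d := by
    ext z
    by_cases hz : z = 1
    · subst hz
      simp [hd]
    · have h0 : a z = 0 := by
        refine hσ.apply_eq_zero (fun x => ?_) hz
        rw [ha, (σ.leftTranslation x).map_starProjection_of_invariant (hL1 x) (hL1' x),
          (σ.rightTranslation x).map_starProjection_of_invariant (hR1 x) (hR1' x), hd,
          σ.rightTranslation_single_one]
      simp [h0, hd, hz]
  by_cases hc : a 1 = 0
  · right
    have hd2 : d ∈ Vᗮᗮ := by
      have := Vᗮ.sub_starProjection_mem_orthogonal d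
      rw [← ha, hau, hc] at this
      simpa using this
    exact σ.eq_zero_of_mem_orthogonal hL2 hd2 (Submodule.le_orthogonal_orthogonal _ hu')
  · left
    have hd1 : d ∈ Vᗮ := by
      have h1 : a ∈ Vᗮ := by rw [ha]; simp
      rw [hau] at h1
      exact (Submodule.smul_mem_iff _ hc).1 h1
    exact σ.eq_zero_of_mem_orthogonal hL1 hd1 (Submodule.le_orthogonal_orthogonal _ hu)

/-! ### Doubly invariant subspaces and the centre -/

section Invariant

variable {H : Type*} [NormedAddCommGroup H] [InnerProductSpace ℂ H] [CompleteSpace H]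

theorem ContinuousLinearMap.starProjection_mul_comm {K : Submodule ℂ H}
    [K.HasOrthogonalProjection] {T : H →L[ℂ] H} (h : ∀ f ∈ K, T f ∈ K)
    (h' : ∀ f ∈ K, star T f ∈ K) : T * K.starProjection = K.starProjection * T := by
  ext w
  refine (Submodule.eq_starProjection_of_mem_orthogonal (h _ (by simp)) ?_).symm
  intro v hv
  have h1 := K.sub_starProjection_mem_orthogonal w _ (h' v hv)
  rwa [ContinuousLinearMap.star_eq_adjoint, ContinuousLinearMap.adjoint_inner_left, map_sub] at h1

variable {Γ : Type*} [Group Γ] {σ : GroupCocycle Γ}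

namespace ProjUnitaryRep

theorem op_one (π : ProjUnitaryRep σ H) : π.op 1 = 1 := by
  simp [op, π.map_one']

theorem op_mul (π : ProjUnitaryRep σ H) (x y : Γ) :
    π.op x * π.op y = (σ x y : ℂ) • π.op (x * y) := π.map_mul' x y

theorem star_op_mul (π : ProjUnitaryRep σ H) (x : Γ) : star (π.op x) * π.op x = 1 :=
  Unitary.coe_star_mul_self (π.toFun x)

theorem op_mul_star (π : ProjUnitaryRep σ H) (x : Γ) : π.op x * star (π.op x) = 1 :=
  Unitary.coe_mul_star_self (π.toFun x)

theorem star_op (π : ProjUnitaryRep σ H) (x : Γ) :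
    star (π.op x) = (((σ x x⁻¹)⁻¹ : Circle) : ℂ) • π.op x⁻¹ := by
  have h1 : π.op x * ((((σ x x⁻¹)⁻¹ : Circle) : ℂ) • π.op x⁻¹) = 1 := by
    rw [mul_smul_comm, op_mul, smul_smul, ← Circle.coe_mul]
    simp [op_one]
  calc star (π.op x) = star (π.op x) * (π.op x * ((((σ x x⁻¹)⁻¹ : Circle) : ℂ) • π.op x⁻¹)) := by
        rw [h1, mul_one]
    _ = _ := by rw [← mul_assoc, star_op_mul, one_mul]

theorem mem_commutant_iff {π : ProjUnitaryRep σ H} {T : H →L[ℂ] H} :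
    T ∈ π.commutant ↔ ∀ x, π.op x * T = T * π.op x := by
  simp [commutant, Set.mem_centralizer_iff]

theorem mem_center_iff {π : ProjUnitaryRep σ H} {T : H →L[ℂ] H} :
    T ∈ (π.vonNeumann : Set (H →L[ℂ] H)) ∩ (π.vonNeumann.commutant : Set (H →L[ℂ] H)) ↔
      (∀ x, π.op x * T = T * π.op x) ∧ ∀ S ∈ π.commutant, S * T = T * S := by
  rw [VonNeumannAlgebra.coe_commutant, coe_vonNeumann, Set.centralizer_centralizer_centralizer,
    ← mem_commutant_iff, Set.mem_inter_iff, and_comm]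
  rfl

theorem star_mem_center {π : ProjUnitaryRep σ H} {T : H →L[ℂ] H}
    (h : T ∈ (π.vonNeumann : Set (H →L[ℂ] H)) ∩ (π.vonNeumann.commutant : Set (H →L[ℂ] H))) :
    star T ∈ (π.vonNeumann : Set (H →L[ℂ] H)) ∩ (π.vonNeumann.commutant : Set (H →L[ℂ] H)) :=
  ⟨star_mem (s := π.vonNeumann) h.1, star_mem (s := π.vonNeumann.commutant) h.2⟩

/-- The projection onto a closed doubly invariant subspace is central. -/
theorem IsDoublyInvariant.starProjection_mem_center {π : ProjUnitaryRep σ H}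
    {K : Submodule ℂ H} [K.HasOrthogonalProjection] (hK : π.IsDoublyInvariant K) :
    K.starProjection ∈
      (π.vonNeumann : Set (H →L[ℂ] H)) ∩ (π.vonNeumann.commutant : Set (H →L[ℂ] H)) := by
  refine mem_center_iff.2 ⟨fun x => ?_, fun S hS => ?_⟩
  · refine ContinuousLinearMap.starProjection_mul_comm (hK.1 x) fun f hf => ?_
    rw [star_op]
    exact K.smul_mem _ (hK.1 _ f hf)
  · exact ContinuousLinearMap.starProjection_mul_comm (hK.2 S hS)
      (hK.2 _ (π.star_mem_commutant hS))

/-- The kernel of an operator commuting with `π(Γ)` and `π(Γ)'` is doubly invariant. -/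
theorem isDoublyInvariant_ker {π : ProjUnitaryRep σ H} {T : H →L[ℂ] H}
    (h1 : ∀ x, Commute T (π.op x)) (h2 : ∀ S ∈ π.commutant, Commute T S) :
    π.IsDoublyInvariant T.ker := by
  have key : ∀ S : H →L[ℂ] H, Commute T S → ∀ f ∈ T.ker, S f ∈ T.ker := by
    intro S hS f hf
    rw [LinearMap.mem_ker] at hf ⊢
    have h3 := DFunLike.congr_fun hS.eq f
    simp only [mul_apply_eq_comp] at h3
    simp only [ContinuousLinearMap.coe_coe] at hf ⊢
    rw [h3, hf, map_zero]
  exact ⟨fun x => key _ (h1 x), fun S hS => key S (h2 S hS)⟩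

/-- The projection onto `K` is central, hence a scalar; a nonzero vector of `K` forces the scalar to
be `1`. -/
theorem eq_bot_or_eq_top_of_isFactor {π : ProjUnitaryRep σ H} (hM : π.vonNeumann.IsFactor)
    {K : Submodule ℂ H} (hc : IsClosed (K : Set H)) (hK : π.IsDoublyInvariant K) :
    K = ⊥ ∨ K = ⊤ := by
  have : CompleteSpace K := hc.completeSpace_coe
  have h := hK.starProjection_mem_center
  rw [hM] at h
  obtain ⟨z, hz⟩ := h
  by_cases hb : K = ⊥
  · exact Or.inl hb
  · right
    obtain ⟨f, hf, hf0⟩ := K.ne_bot_iff.1 hb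
    have h1 : z • f = f := by
      have h2 := DFunLike.congr_fun hz f
      simpa [Submodule.starProjection_eq_self_iff.2 hf] using h2
    have hz1 : z = 1 := by
      have h3 : (z - 1) • f = 0 := by rw [sub_smul, h1, one_smul, sub_self]
      exact sub_eq_zero.1 ((smul_eq_zero.1 h3).resolve_right hf0)
    refine K.eq_top_iff'.2 fun w => ?_
    have h4 := DFunLike.congr_fun hz w
    simp only [hz1, one_smul, one_apply_eq_self] at h4
    rw [h4]
    simp

/-- A central `T` is normal. Two points of its spectrum would give continuous functions with product
zero but neither zero on the spectrum. Kernels of continuous functions of `T` thus replace spectral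
projections. -/
theorem isFactor_of_forall_eq_bot_or_eq_top {π : ProjUnitaryRep σ H}
    (h : ∀ K : Submodule ℂ H, IsClosed (K : Set H) → π.IsDoublyInvariant K → K = ⊥ ∨ K = ⊤) :
    π.vonNeumann.IsFactor := by
  refine Set.Subset.antisymm ?_ ?_
  · intro T hT
    cases subsingleton_or_nontrivial H with
    | inl hs => exact ⟨0, Subsingleton.elim _ _⟩
    | inr hn =>
    have hT1 := mem_center_iff.1 hT
    have hT2 := mem_center_iff.1 (star_mem_center hT)
    have hnormal : IsStarNormal T :=
      ⟨by
        have := hT.2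
        rw [VonNeumannAlgebra.coe_commutant] at this
        exact this _ (star_mem_center hT).1⟩
    have hinv : ∀ f : ℂ → ℂ, π.IsDoublyInvariant (cfc f T).ker := fun f =>
      isDoublyInvariant_ker
        (fun x => Commute.cfc (hT1.1 x).symm (hT2.1 x).symm f)
        (fun S hS => Commute.cfc (hT1.2 S hS).symm (hT2.2 S hS).symm f)
    have hdisj : ∀ f g : ℂ → ℂ, Continuous f → Continuous g → (∀ z, f z * g z = 0) →
        cfc f T = 0 ∨ cfc g T = 0 := by
      intro f g hf hg hfg
      have hmul : cfc f T * cfc g T = 0 := by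
        rw [← cfc_mul f g T hf.continuousOn hg.continuousOn]
        simp [hfg]
      -- The range of `cfc g T` lies in the kernel of `cfc f T`, which is trivial or everything.
      rcases h _ (cfc f T).isClosed_ker (hinv f) with hk | hk
      · right
        ext w
        have h1 : cfc g T w ∈ (cfc f T).ker := by
          have := DFunLike.congr_fun hmul w
          simpa using this
        rw [hk] at h1
        simpa using h1
      · left
        ext w
        have h1 : w ∈ (cfc f T).ker := by rw [hk]; trivial
        simpa using h1
    have hzero : ∀ f : ℂ → ℂ, Continuous f → cfc f T = 0 → ∀ z ∈ spectrum ℂ T, f z = 0 := by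
      intro f hf h0 z hz
      rw [← cfc_const_zero ℂ T] at h0
      exact (cfc_eq_cfc_iff_eqOn (hf := hf.continuousOn)).1 h0 hz
    obtain ⟨l, hl⟩ := spectrum.nonempty T
    have hspec : ∀ m ∈ spectrum ℂ T, m = l := by
      intro m hm
      by_contra hne
      have hd : 0 < dist m l := dist_pos.2 hne
      -- Tent functions of radius `dist m l / 2`: those centred at `l` and `m` have product zero.
      let b : ℂ → ℂ → ℂ := fun c z => ((max 0 (dist m l / 2 - dist z c) : ℝ) : ℂ)
      have hb : ∀ c, Continuous (b c) := fun c => by fun_prop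
      have hbc : ∀ c, b c c ≠ 0 := fun c => by
        have : 0 < max 0 (dist m l / 2 - dist c c) := by
          rw [dist_self]; exact lt_max_of_lt_right (by linarith)
        exact Complex.ofReal_ne_zero.2 this.ne'
      rcases hdisj (b l) (b m) (hb l) (hb m) (fun z => by
        have htri := dist_triangle_left m l z
        rcases le_total (dist m l / 2) (dist z l) with h1 | h1
        · simp [b, h1]
        · have h2 : dist m l / 2 ≤ dist z m := by linarith
          simp [b, h2]) with h0 | h0
      · exact hbc l (hzero _ (hb l) h0 l hl)
      · exact hbc m (hzero _ (hb m) h0 m hm)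
    refine ⟨l, ?_⟩
    have h1 : cfc (fun z : ℂ => z) T = cfc (fun _ : ℂ => l) T := cfc_congr hspec
    rw [cfc_id' ℂ T, cfc_const l T, Algebra.algebraMap_eq_smul_one] at h1
    exact h1.symm
  · rintro _ ⟨z, rfl⟩
    exact mem_center_iff.2 ⟨by simp, by simp⟩

theorem forall_eq_bot_or_eq_top_iff_isFactor (π : ProjUnitaryRep σ H) :
    (∀ K : Submodule ℂ H, IsClosed (K : Set H) → π.IsDoublyInvariant K → K = ⊥ ∨ K = ⊤) ↔
      π.vonNeumann.IsFactor :=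
  ⟨isFactor_of_forall_eq_bot_or_eq_top, fun hM _ hc hK => eq_bot_or_eq_top_of_isFactor hM hc hK⟩

end ProjUnitaryRep

end Invariant

/-! ### Coefficient operators of square-integrable representations -/

namespace ProjUnitaryRep

section Coefficient

variable {Γ : Type*} [Group Γ] {σ : GroupCocycle Γ}
  {H : Type*} [NormedAddCommGroup H] [InnerProductSpace ℂ H] [CompleteSpace H]

/-- The coefficient operator `f ↦ (⟨f, π(γ) g⟩)_γ`, bounded by the closed graph theorem. -/
noncomputable def coefficient (π : ProjUnitaryRep σ H) (g : H)
    (hg : ∀ f : H, Memℓp (fun γ : Γ => inner ℂ (π.op γ g) f) 2) :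
    H →L[ℂ] lp (fun _ : Γ => ℂ) 2 :=
  ContinuousLinearMap.ofSeqClosedGraph
    (g :=
      { toFun := fun f => (⟨fun γ : Γ => inner ℂ (π.op γ g) f, hg f⟩ : lp (fun _ : Γ => ℂ) 2)
        map_add' := fun f f' => by ext γ; exact inner_add_right _ _ _
        map_smul' := fun a f => by ext γ; exact inner_smul_right _ _ _ })
    (by
      intro u x y hu hy
      ext γ
      -- Both limits are compared coordinatewise: evaluation at `γ` is continuous on `ℓ²(Γ)`.
      have h1 := ((lp.evalCLM ℂ (fun _ : Γ => ℂ) 2 γ).continuous.tendsto y).comp hy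
      have h2 : Filter.Tendsto (fun n => inner ℂ (π.op γ g) (u n)) Filter.atTop
          (nhds (inner ℂ (π.op γ g) x)) := tendsto_const_nhds.inner hu
      exact tendsto_nhds_unique h1 h2)

theorem coefficient_apply (π : ProjUnitaryRep σ H) (g : H)
    (hg : ∀ f : H, Memℓp (fun γ : Γ => inner ℂ (π.op γ g) f) 2) (f : H) (γ : Γ) :
    π.coefficient g hg f γ = inner ℂ (π.op γ g) f := rfl

/-- The coefficient operators intertwine `π` with the twisted left translations. -/
theorem leftTranslation_coefficient (π : ProjUnitaryRep σ H) (g : H)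
    (hg : ∀ f : H, Memℓp (fun γ : Γ => inner ℂ (π.op γ g) f) 2) (x : Γ) (f : H) :
    σ.leftTranslation x (π.coefficient g hg (π.op x f)) = π.coefficient g hg f := by
  ext z
  have h1 : π.op x (π.op z g) = (σ x z : ℂ) • π.op (x * z) g :=
    DFunLike.congr_fun (π.op_mul x z) g
  have h2 : inner ℂ (π.op x (π.op z g)) (π.op x f) = inner ℂ (π.op z g) f := by
    rw [← ContinuousLinearMap.adjoint_inner_right, ← ContinuousLinearMap.star_eq_adjoint]
    exact congrArg _ (DFunLike.congr_fun (π.star_op_mul x) f)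
  rw [GroupCocycle.leftTranslation_apply, coefficient_apply, coefficient_apply, ← h2, h1,
    inner_smul_left, Circle.coe_inv_eq_conj]

theorem leftTranslation_symm_coefficient (π : ProjUnitaryRep σ H) (g : H)
    (hg : ∀ f : H, Memℓp (fun γ : Γ => inner ℂ (π.op γ g) f) 2) (x : Γ) (f : H) :
    (σ.leftTranslation x).symm (π.coefficient g hg f) = π.coefficient g hg (π.op x f) := by
  rw [← π.leftTranslation_coefficient g hg x, LinearIsometryEquiv.symm_apply_apply]

/-- An operator on `ℓ²(Γ)` commuting with left translations gives, between two coefficient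
operators, an element of `π(Γ)'`. -/
theorem adjoint_coefficient_mem_commutant (π : ProjUnitaryRep σ H) (g g' : H)
    (hg : ∀ f : H, Memℓp (fun γ : Γ => inner ℂ (π.op γ g) f) 2)
    (hg' : ∀ f : H, Memℓp (fun γ : Γ => inner ℂ (π.op γ g') f) 2)
    (A : lp (fun _ : Γ => ℂ) 2 →L[ℂ] lp (fun _ : Γ => ℂ) 2)
    (hA : ∀ x v, A (σ.leftTranslation x v) = σ.leftTranslation x (A v)) :
    (ContinuousLinearMap.adjoint (π.coefficient g' hg')).comp
      (A.comp (π.coefficient g hg)) ∈ π.commutant := by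
  refine mem_commutant_iff.2 fun x => ?_
  ext f
  refine ext_inner_left ℂ fun v => ?_
  have h1 : inner ℂ v (π.op x (ContinuousLinearMap.adjoint (π.coefficient g' hg')
        (A (π.coefficient g hg f))))
      = inner ℂ (π.coefficient g' hg' (star (π.op x) v)) (A (π.coefficient g hg f)) := by
    rw [← ContinuousLinearMap.adjoint_inner_left, ContinuousLinearMap.adjoint_inner_right,
      ContinuousLinearMap.star_eq_adjoint]
  have h2 : π.op x (star (π.op x) v) = v := DFunLike.congr_fun (π.op_mul_star x) v
  have h3 : inner ℂ v (ContinuousLinearMap.adjoint (π.coefficient g' hg')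
        (A (π.coefficient g hg (π.op x f))))
      = inner ℂ (π.coefficient g' hg' (star (π.op x) v)) (A (π.coefficient g hg f)) := by
    rw [ContinuousLinearMap.adjoint_inner_right, ← (σ.leftTranslation x).inner_map_map, ← hA,
      leftTranslation_coefficient]
    conv_lhs => rw [← h2]
    rw [leftTranslation_coefficient]
  exact h1.trans h3.symm

/-- Under Kleppner's condition, a square-integrable `σ`-representation has no nontrivial closed
doubly invariant subspaces. -/
theorem IsSquareIntegrable.eq_bot_or_eq_top {π : ProjUnitaryRep σ H}
    (hπ : π.IsSquareIntegrable) (hσ : σ.Kleppner) {K : Submodule ℂ H}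
    (hc : IsClosed (K : Set H)) (hK : π.IsDoublyInvariant K) : K = ⊥ ∨ K = ⊤ := by
  have : CompleteSpace K := hc.completeSpace_coe
  obtain ⟨D, hD, hDmem⟩ := hπ
  by_contra! hne
  have hex : ∀ f : H, f ≠ 0 → ∃ g ∈ D, inner ℂ g f ≠ 0 := by
    intro f hf
    by_contra! h
    exact hf (hD.eq_zero_of_inner_right ℂ fun g hg => h g hg)
  obtain ⟨f, hf, hf0⟩ := K.ne_bot_iff.1 hne.1
  obtain ⟨f', hf', hf0'⟩ := Kᗮ.ne_bot_iff.1 (fun h => hne.2 (K.orthogonal_eq_bot_iff.1 h))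
  obtain ⟨g, hgD, hgf⟩ := hex f hf0
  obtain ⟨g', hgD', hgf'⟩ := hex f' hf0'
  have hg := fun f => hDmem f g hgD
  have hg' := fun f => hDmem f g' hgD'
  -- Letting `A` range over the whole commutant of the left translations makes `V` right-invariant,
  -- since `A` may be composed with a right translation. Left translations pass through `A` and act
  -- on `K` through `π`.
  let V : Submodule ℂ (lp (fun _ : Γ => ℂ) 2) := Submodule.span ℂ
    {v | ∃ A : lp (fun _ : Γ => ℂ) 2 →L[ℂ] lp (fun _ : Γ => ℂ) 2,
      (∀ x v, A (σ.leftTranslation x v) = σ.leftTranslation x (A v)) ∧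
        ∃ k ∈ K, v = A (π.coefficient g hg k)}
  have hsymm : ∀ A : lp (fun _ : Γ => ℂ) 2 →L[ℂ] lp (fun _ : Γ => ℂ) 2,
      (∀ x v, A (σ.leftTranslation x v) = σ.leftTranslation x (A v)) →
        ∀ x v, A ((σ.leftTranslation x).symm v) = (σ.leftTranslation x).symm (A v) := by
    intro A hA x v
    rw [LinearIsometryEquiv.eq_symm_apply, ← hA, LinearIsometryEquiv.apply_symm_apply]
  have hstar : ∀ x, ∀ k ∈ K, star (π.op x) k ∈ K := fun x k hk => by
    rw [star_op]
    exact K.smul_mem _ (hK.1 _ k hk)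
  have hinv : ∀ U : lp (fun _ : Γ => ℂ) 2 →ₗ[ℂ] lp (fun _ : Γ => ℂ) 2,
      (∀ A : lp (fun _ : Γ => ℂ) 2 →L[ℂ] lp (fun _ : Γ => ℂ) 2,
        (∀ x v, A (σ.leftTranslation x v) = σ.leftTranslation x (A v)) → ∀ k ∈ K,
          U (A (π.coefficient g hg k)) ∈ V) → ∀ v ∈ V, U v ∈ V := by
    intro U hU v hv
    have hle : V ≤ V.comap U := Submodule.span_le.2 (by
      rintro _ ⟨A, hA, k, hk, rfl⟩
      exact hU A hA k hk)
    exact hle hv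
  have hRcomm : ∀ y x v, (σ.rightTranslation y).symm (σ.leftTranslation x v)
      = σ.leftTranslation x ((σ.rightTranslation y).symm v) := by
    intro y x v
    rw [LinearIsometryEquiv.symm_apply_eq, ← σ.leftTranslation_rightTranslation,
      LinearIsometryEquiv.apply_symm_apply]
  have horth : π.coefficient g' hg' f' ∈ Vᗮ := by
    have hle : V ≤ (Submodule.span ℂ {π.coefficient g' hg' f'})ᗮ := Submodule.span_le.2 (by
      rintro _ ⟨A, hA, k, hk, rfl⟩
      rw [SetLike.mem_coe, Submodule.mem_orthogonal_singleton_iff_inner_right]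
      have h1 := hK.2 _ (π.adjoint_coefficient_mem_commutant g g' hg hg' A hA) k hk
      have h2 := Submodule.inner_left_of_mem_orthogonal h1 hf'
      rwa [ContinuousLinearMap.comp_apply, ContinuousLinearMap.adjoint_inner_right] at h2)
    exact (Submodule.isOrtho_iff_le.2 hle).symm (Submodule.mem_span_singleton_self _)
  have hmem : π.coefficient g hg f ∈ V :=
    Submodule.subset_span ⟨.id ℂ _, fun _ _ => rfl, f, hf, rfl⟩
  have hV := hσ.eq_zero_or_eq_zero (V := V)
    (fun x => hinv (σ.leftTranslation x).toLinearEquiv fun A hA k hk =>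
      Submodule.subset_span ⟨A, hA, star (π.op x) k, hstar x k hk, by
        have h2 : π.op x (star (π.op x) k) = k := DFunLike.congr_fun (π.op_mul_star x) k
        conv_lhs => rw [← h2]
        exact (hA _ _).symm.trans (congrArg A (π.leftTranslation_coefficient g hg x _))⟩)
    (fun x => hinv (σ.leftTranslation x).symm.toLinearEquiv fun A hA k hk =>
      Submodule.subset_span ⟨A, hA, π.op x k, hK.1 x k hk, by
        rw [← π.leftTranslation_symm_coefficient g hg x, hsymm A hA]; rfl⟩)
    (fun y => hinv (σ.rightTranslation y).toLinearEquiv fun A hA k hk =>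
      Submodule.subset_span
        ⟨(σ.rightTranslation y).toContinuousLinearEquiv.toContinuousLinearMap.comp A,
          fun x v => (congrArg (σ.rightTranslation y) (hA x v)).trans
            (σ.leftTranslation_rightTranslation x y (A v)).symm, k, hk, rfl⟩)
    (fun y => hinv (σ.rightTranslation y).symm.toLinearEquiv fun A hA k hk =>
      Submodule.subset_span
        ⟨(σ.rightTranslation y).symm.toContinuousLinearEquiv.toContinuousLinearMap.comp A,
          fun x v => (congrArg (σ.rightTranslation y).symm (hA x v)).trans (hRcomm y x (A v)),
          k, hk, rfl⟩)
    hmem horth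
  -- The coordinate at the identity of the coefficient vector is `⟨g, f⟩`.
  have hval : ∀ g hg f, inner ℂ g f ≠ 0 → π.coefficient g hg f ≠ 0 := by
    intro g hg f hgf h0
    apply hgf
    have h1 : π.coefficient g hg f 1 = 0 := by rw [h0]; rfl
    rwa [coefficient_apply, op_one, one_apply_eq_self] at h1
  exact hV.elim (hval g hg f hgf) (hval g' hg' f' hgf')

end Coefficient

end ProjUnitaryRep

theorem mainTheorem8 {Γ : Type*} [Group Γ] [Countable Γ] (σ : GroupCocycle Γ)
    {H : Type*} [NormedAddCommGroup H] [InnerProductSpace ℂ H] [CompleteSpace H]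
    [TopologicalSpace.SeparableSpace H]
    (π : ProjUnitaryRep σ H) (hπ : π.IsSquareIntegrable) :
    (σ.Kleppner →
      (∀ K : Submodule ℂ H, IsClosed (K : Set H) → π.IsDoublyInvariant K → K = ⊥ ∨ K = ⊤) ∧
      π.vonNeumann.IsFactor) ∧
    ((∀ K : Submodule ℂ H, IsClosed (K : Set H) → π.IsDoublyInvariant K → K = ⊥ ∨ K = ⊤) ↔
      π.vonNeumann.IsFactor) :=
  ⟨fun hσ => ⟨fun _ hc hK => hπ.eq_bot_or_eq_top hσ hc hK,
    π.forall_eq_bot_or_eq_top_iff_isFactor.1 fun _ hc hK => hπ.eq_bot_or_eq_top hσ hc hK⟩,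
    π.forall_eq_bot_or_eq_top_iff_isFactor⟩
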